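/- Let $d\ge 2$ and $n\ge 1$. The state space of $n$ qudits is $(\mathbb C^d)^{\otimes n}$ with orthonormal basis $|x_0x_1\cdots x_{n-1}\rangle$, $0\le x_k\le d-1$. A \emph{local} unitary is an element $W_0\otimes\cdots\otimes W_{n-1}$ of $U(d)^{\otimes n}$. For distinct qudits $c$ (control) and $t$ (target) and $V\in U(d)$, let $\wedge_1(V)$ be the unitary that applies $V$ to qudit $t$ if qudit $c$ is in state $|d-1\rangle$ and fixes all basis kets in which qudit $c$ is in another state (on two qudits, $\wedge_1(V)=I_{d^2-d}\oplus V$). Let $\mathtt{INC}|j\rangle=|(j+1)\bmod d\rangle$ and $\mathtt{CINC}=\wedge_1(\mathtt{INC})$. Let $\sigma_x\oplus I_{d-2}$ be the one-qudit unitary that exchanges $|0\rangle$ and $|1\rangle$ and fixes $|j\rangle$ for $j\ge 2$, and call $\wedge_1(\sigma_x\oplus I_{d-2})$ the controlled flip. Then: 1. For every ordered pair $(c,t)$ of distinct qudits and every $V\in U(d)$, the gate $\wedge_1(V)$ with control $c$ and target $t$ is exactly equal to a finite product of local unitaries that are trivial on all qudits other than $c$ and $t$, exactly $d$ copies of $\mathtt{CINC}$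 and exactly $d$ copies of $\mathtt{CINC}^{-1}$, where all these copies have control $c$ and target $t$. 2. For every such pair, each of $\mathtt{CINC}$ and $\mathtt{CINC}^{-1}$ with control $c$ and target $t$ is exactly equal to a product of local unitaries that are trivial on the other qudits and exactly $d-1$ controlled flips with control $c$ and target $t$. Likewise every $\wedge_1(V)$ with control $c$ and target $t$ is exactly equal to a product of such local unitaries and exactly $2d(d-1)$ controlled flips with control $c$ and target $t$. 3. $\mathtt{CINC}^{-1}=\mathtt{CINC}^{d-1}$ for every ordered pair of distinct qudits. 4. Every unitary operator on $(\mathbb C^d)^{\otimes n}$ is exactly equal to a finite product of local unitaries and of copies of $\mathtt{CINC}$ and $\mathtt{CINC}^{-1}$ on ordered pairs of distinct qudits; that is, $U(d)^{\otimes n}\sqcup\{\mathtt{CINC},\mathtt{CINC}^{-1}\}$ is exact-universal. The same holds with local unitaries and copies of $\mathtt{CINC}$ alone; that is, $U(d)^{\otimes n}\sqcup\{\mathtt{CINC}\}$ is exact-universal. -/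

import Mathlib

/-- The group `U(d^n)` of unitaries on `n` qudits with `d` levels. The computational basis kets
`|x₀ x₁ … x_{n-1}⟩` are indexed by the functions `x : Fin n → Fin d`; an element is written as a
matrix whose entry at `(x, y)` is `⟨x| U |y⟩`. -/
abbrev QuditUnitary (d n : ℕ) : Type := Matrix.unitaryGroup (Fin n → Fin d) ℂ

/-- The group `U(d)` of one-qudit unitaries. -/
abbrev OneQudit (d : ℕ) : Type := Matrix.unitaryGroup (Fin d) ℂ

/-- The one-qudit unitary `|j⟩ ↦ |σ j⟩`. -/
def permUnitary {d : ℕ} (σ : Equiv.Perm (Fin d)) : OneQudit d :=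
  ⟨Matrix.of fun i j => if i = σ j then (1 : ℂ) else 0, by
    rw [Matrix.mem_unitaryGroup_iff']
    ext i j
    simp [Matrix.mul_apply, Matrix.star_apply, Matrix.one_apply, eq_comm]⟩

/-- The modular increment `INC |j⟩ = |(j + 1) mod d⟩` (addition in `Fin d` is modulo `d`). -/
def incUnitary (d : ℕ) [NeZero d] : OneQudit d := permUnitary (Equiv.addRight (1 : Fin d))

/-- The flip `σ_x ⊕ I_{d-2}`, exchanging `|0⟩` and `|1⟩` (used for `2 ≤ d`). -/
def flipUnitary (d : ℕ) [NeZero d] : OneQudit d := permUnitary (Equiv.swap (0 : Fin d) 1)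

/-- The local unitary `W₀ ⊗ W₁ ⊗ ⋯ ⊗ W_{n-1}`. -/
def localUnitary {d n : ℕ} (W : Fin n → OneQudit d) : QuditUnitary d n :=
  ⟨Matrix.of fun x y => ∏ k, (W k : Matrix (Fin d) (Fin d) ℂ) (x k) (y k), by
    rw [Matrix.mem_unitaryGroup_iff]
    ext x y
    have h : ∀ k, ∑ a, (W k : Matrix (Fin d) (Fin d) ℂ) (x k) a *
        star ((W k : Matrix (Fin d) (Fin d) ℂ) (y k) a) = if x k = y k then 1 else 0 := by
      intro k
      have := congrFun (congrFun (Matrix.mem_unitaryGroup_iff.mp (W k).2) (x k)) (y k)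
      simpa [Matrix.mul_apply, Matrix.star_apply, Matrix.one_apply] using this
    simp only [Matrix.mul_apply, Matrix.star_apply, Matrix.of_apply, star_prod,
      ← Finset.prod_mul_distrib, Matrix.one_apply]
    rw [← Fintype.piFinset_univ, ← Finset.prod_univ_sum (fun _ => Finset.univ)
      (fun k a => (W k : Matrix (Fin d) (Fin d) ℂ) (x k) a *
        star ((W k : Matrix (Fin d) (Fin d) ℂ) (y k) a))]
    simp only [h, Finset.prod_ite_zero, Finset.prod_const_one, funext_iff, Finset.mem_univ,
      true_implies]⟩

/-- The singly-controlled gate `∧₁(V)` with control qudit `c` and target qudit `t`: it applies `V`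
to qudit `t` if qudit `c` is in the state `|d-1⟩`, and fixes every ket in which `c` is not in the
state `|d-1⟩`. For `n = 2`, `c = 0`, `t = 1` this is `I_{d²-d} ⊕ V`. -/
def controlled {d n : ℕ} (c t : Fin n) (h : c ≠ t) (V : OneQudit d) : QuditUnitary d n :=
  ⟨Matrix.of fun x y =>
      if ∀ k, k ≠ t → x k = y k then
        (if (x c : ℕ) + 1 = d then (V : Matrix (Fin d) (Fin d) ℂ) else 1) (x t) (y t)
      else 0, by
    rw [Matrix.mem_unitaryGroup_iff]
    ext x y
    set A : (Fin n → Fin d) → Matrix (Fin d) (Fin d) ℂ :=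
      fun x => if (x c : ℕ) + 1 = d then (V : Matrix (Fin d) (Fin d) ℂ) else 1 with hA
    have hU : A x * star (A x) = 1 := by
      simp only [hA]
      split_ifs
      · exact Matrix.mem_unitaryGroup_iff.mp V.2
      · simp
    simp only [Matrix.mul_apply, Matrix.star_apply, Matrix.of_apply, Matrix.one_apply]
    by_cases hxy : ∀ k, k ≠ t → x k = y k
    · have hAy : A y = A x := by simp only [hA, hxy c h]
      have hxy' : (x = y) ↔ x t = y t := by
        refine ⟨fun e => by rw [e], fun e => funext fun k => ?_⟩
        by_cases hk : k = t
        · rw [hk, e]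
        · exact hxy k hk
      have key : ∑ a, A x (x t) a * star (A x (y t) a) = if x t = y t then 1 else 0 := by
        have := congrFun (congrFun hU (x t)) (y t)
        simpa only [Matrix.mul_apply, Matrix.star_apply, Matrix.one_apply] using this
      simp only [hxy']
      rw [← key]
      symm
      refine Finset.sum_of_injOn (fun a => Function.update x t a)
        (fun a _ b _ e => by simpa using congrFun e t) (by simp) ?_ ?_
      · intro z _ hz
        have : ¬ ∀ k, k ≠ t → x k = z k := by
          intro hk
          apply hz
          refine ⟨z t, by simp, funext fun k => ?_⟩
          by_cases hkt : k = t
          · subst hkt; simp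
          · simp [Function.update_of_ne hkt, hk k hkt]
        simp [this]
      · intro a _
        have h1 : ∀ k, k ≠ t → x k = Function.update x t a k :=
          fun k hk => by rw [Function.update_of_ne hk]
        have h2 : ∀ k, k ≠ t → y k = Function.update x t a k :=
          fun k hk => by rw [Function.update_of_ne hk, hxy k hk]
        simp only [if_pos h1, if_pos h2, Function.update_self]
        change _ = A x (x t) a * star (A y (y t) a)
        rw [hAy]
    · have hne : x ≠ y := fun e => hxy fun k _ => by rw [e]
      rw [if_neg hne]
      refine Finset.sum_eq_zero fun z _ => ?_
      by_cases h1 : ∀ k, k ≠ t → x k = z k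
      · have h2 : ¬ ∀ k, k ≠ t → y k = z k :=
          fun h2 => hxy fun k hk => (h1 k hk).trans (h2 k hk).symm
        simp [h2]
      · simp [h1]⟩

/-- `CINC = ∧₁(INC)` with control qudit `c` and target qudit `t`. -/
def cincUnitary {d n : ℕ} [NeZero d] (c t : Fin n) (h : c ≠ t) : QuditUnitary d n :=
  controlled c t h (incUnitary d)

/-- The controlled flip `∧₁(σ_x ⊕ I_{d-2})` with control qudit `c` and target qudit `t`. -/
def cflipUnitary {d n : ℕ} [NeZero d] (c t : Fin n) (h : c ≠ t) : QuditUnitary d n :=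
  controlled c t h (flipUnitary d)

/-- The gates of circuits on `n` qudits: local unitaries, and placed copies (control `c`,
target `t`) of `CINC`, `CINC⁻¹` and of the controlled flip. -/
inductive QuditGate (d n : ℕ) : Type
  | loc (W : Fin n → OneQudit d)
  | cinc (c t : Fin n) (h : c ≠ t)
  | cincInv (c t : Fin n) (h : c ≠ t)
  | cflip (c t : Fin n) (h : c ≠ t)

namespace QuditGate

/-- The unitary that a gate performs. -/
def eval {d n : ℕ} [NeZero d] : QuditGate d n → QuditUnitary d n
  | loc W => localUnitary W
  | cinc c t h => cincUnitary c t h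
  | cincInv c t h => (cincUnitary c t h)⁻¹
  | cflip c t h => cflipUnitary c t h

/-- The gate involves only the qudits `c` and `t`: a local gate is trivial on all the other qudits,
and a two-qudit gate has control `c` and target `t`. -/
def OnPair {d n : ℕ} (c t : Fin n) : QuditGate d n → Prop
  | loc W => ∀ k, k ≠ c → k ≠ t → W k = 1
  | cinc c' t' _ => c' = c ∧ t' = t
  | cincInv c' t' _ => c' = c ∧ t' = t
  | cflip c' t' _ => c' = c ∧ t' = t

def isCinc {d n : ℕ} : QuditGate d n → Bool
  | cinc _ _ _ => true
  | _ => false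

def isCincInv {d n : ℕ} : QuditGate d n → Bool
  | cincInv _ _ _ => true
  | _ => false

def isCflip {d n : ℕ} : QuditGate d n → Bool
  | cflip _ _ _ => true
  | _ => false

end QuditGate

/-- The list of gates `C` is an exact circuit for `U` (the product is taken in the order of
operator composition) that uses, besides local unitaries, exactly `a` copies of `CINC`, `b` copies
of `CINC⁻¹` and `f` controlled flips. -/
def IsCircuitFor {d n : ℕ} [NeZero d] (C : List (QuditGate d n)) (U : QuditUnitary d n)
    (a b f : ℕ) : Prop :=
  (C.map QuditGate.eval).prod = U ∧ C.countP QuditGate.isCinc = a ∧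
    C.countP QuditGate.isCincInv = b ∧ C.countP QuditGate.isCflip = f

/-- The local unitaries `U(d)^{⊗n}`. -/
def localGates (d n : ℕ) : Set (QuditUnitary d n) := Set.range localUnitary

/-- The copies of `CINC` on ordered pairs of distinct qudits. -/
def cincGates (d n : ℕ) [NeZero d] : Set (QuditUnitary d n) :=
  {g | ∃ (c t : Fin n) (h : c ≠ t), g = cincUnitary c t h}

/-- The copies of `CINC⁻¹` on ordered pairs of distinct qudits. -/
def cincInvGates (d n : ℕ) [NeZero d] : Set (QuditUnitary d n) :=
  {g | ∃ (c t : Fin n) (h : c ≠ t), g = (cincUnitary c t h)⁻¹}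

/-- A gate library is exact-universal if every `n`-qudit unitary equals a finite product of gates
from the library. -/
def IsExactUniversal {d n : ℕ} (L : Set (QuditUnitary d n)) : Prop :=
  ∀ U : QuditUnitary d n, ∃ l : List (QuditUnitary d n), (∀ g ∈ l, g ∈ L) ∧ l.prod = U

/-!
**Exact circuits for `∧₁(V)`.** By the spectral theorem a unitary `V ∈ U(d)` is `z • W D W⁻¹` with
`|z| = 1` and `D` diagonal of determinant `1`. The entries of `D` have product `1` around the
cycle `0 → 1 → ⋯ → d - 1 → 0` of `INC`, so they form a coboundary, and `D = A INC A⁻¹ INC⁻¹` for a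
diagonal `A` (`exists_eq_phase_mul_conj_commutator`). The map `V ↦ ∧₁(V)` is a homomorphism,
conjugation of `V` is conjugation of `∧₁(V)` by a local unitary on the target, and a controlled
phase is a local unitary on the control (`controlled_phaseUnitary`). Hence `∧₁(V)` needs a single
`CINC` and a single `CINC⁻¹`; cancelling pairs `CINC · CINC⁻¹` bring the numbers up to `d`
(`HasCircuit.controlled_of_cinc`). Since `INC` is a `d`-cycle, it is a product of `d - 1`
transpositions, each conjugate to the flip, which gives the circuits with controlled flips.

**Universality.** Let `G` be the group generated by the local unitaries and `CINC`. Gates with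
many controls lie in `G` by induction on the number of controls (`multiControlled_mem`): the part
of determinant `1` is a commutator of gates with fewer controls, and a controlled phase on the
target is a gate with one control less whose target is a former control. So every uniformly
controlled gate, and in particular every diagonal unitary, is in `G`, and `G` moves any vector to
a multiple of `|0 … 0⟩` one qudit at a time (`exists_mem_mulVec_eq_zero`). Finally a unitary with
orthonormal eigenvectors `b_j` is a product of unitaries that multiply one `b_j` by a phase, and
each of these is conjugate under `G` to a diagonal unitary. As `CINC⁻¹` is a power of `CINC` and
inverses of local unitaries are local, products of generators suffice.
-/

/-! ### Diagonal, permutation and diagonalized unitaries -/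

/-- The diagonal unitary with the phases `f i` on its diagonal, as a group homomorphism. -/
def diagonalUnitary {ι : Type*} [Fintype ι] [DecidableEq ι] :
    (ι → unitary ℂ) →* Matrix.unitaryGroup ι ℂ where
  toFun f := ⟨Matrix.diagonal fun i => (f i : ℂ), by
    rw [Matrix.mem_unitaryGroup_iff, Matrix.star_eq_conjTranspose, Matrix.diagonal_conjTranspose,
      Matrix.diagonal_mul_diagonal, ← Matrix.diagonal_one]
    congr 1
    ext i
    exact Unitary.mul_star_self_of_mem (f i).2⟩
  map_one' := by ext i j; simp
  map_mul' f g := by ext i j; simp [Matrix.diagonal_mul_diagonal]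

theorem coe_diagonalUnitary {ι : Type*} [Fintype ι] [DecidableEq ι] (f : ι → unitary ℂ) :
    (diagonalUnitary f : Matrix ι ι ℂ) = Matrix.diagonal fun i => (f i : ℂ) := rfl

/-- The scalar unitary `z • 1`. -/
def phaseUnitary {ι : Type*} [Fintype ι] [DecidableEq ι] (z : unitary ℂ) :
    Matrix.unitaryGroup ι ℂ :=
  diagonalUnitary fun _ => z

theorem coe_phaseUnitary {ι : Type*} [Fintype ι] [DecidableEq ι] (z : unitary ℂ) :
    ((phaseUnitary z : Matrix.unitaryGroup ι ℂ) : Matrix ι ι ℂ) = (z : ℂ) • 1 := by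
  rw [phaseUnitary, coe_diagonalUnitary, Matrix.smul_one_eq_diagonal]

theorem phaseUnitary_comm {ι : Type*} [Fintype ι] [DecidableEq ι] (z : unitary ℂ)
    (V : Matrix.unitaryGroup ι ℂ) : phaseUnitary z * V = V * phaseUnitary z := by
  ext i j
  simp [coe_phaseUnitary]

theorem exists_norm_eq_one_isUnit_smul_one_sub {ι : Type*} [Fintype ι] [DecidableEq ι]
    (U : Matrix ι ι ℂ) : ∃ c : ℂ, ‖c‖ = 1 ∧ IsUnit (c • (1 : Matrix ι ι ℂ) - U) := by
  have hinf : (Metric.sphere (0 : ℂ) 1).Infinite := by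
    refine (isPreconnected_sphere (by simp) 0 1).infinite_of_nontrivial ?_
    exact ⟨1, by simp, -1, by simp, by norm_num⟩
  obtain ⟨c, hc, hroot⟩ := hinf.exists_notMem_finset U.charpoly.roots.toFinset
  refine ⟨c, by simpa using hc, ?_⟩
  rw [Matrix.isUnit_iff_isUnit_det, isUnit_iff_ne_zero]
  intro h0
  apply hroot
  rw [Multiset.mem_toFinset, Polynomial.mem_roots U.charpoly_monic.ne_zero, Polynomial.IsRoot,
    Matrix.eval_charpoly, ← h0, Matrix.scalar_apply, Matrix.smul_one_eq_diagonal]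

/-- The spectral theorem for unitary matrices. It is reduced to the Hermitian case by a Cayley
transform based at a point of the unit circle that is not an eigenvalue. -/
theorem exists_conj_diagonalUnitary {ι : Type*} [Fintype ι] [DecidableEq ι]
    (U : Matrix.unitaryGroup ι ℂ) :
    ∃ (W : Matrix.unitaryGroup ι ℂ) (f : ι → unitary ℂ), U = W * diagonalUnitary f * W⁻¹ := by
  obtain ⟨c, hc, hu⟩ := exists_norm_eq_one_isUnit_smul_one_sub (U : Matrix ι ι ℂ)
  have hcc : star c * c = 1 := by
    rw [Complex.star_def, Complex.conj_mul', hc]; norm_num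
  obtain ⟨M, hM⟩ := hu
  have hUU : star (U : Matrix ι ι ℂ) * U = 1 := Unitary.coe_star_mul_self U
  -- `H = i (c + U) (c - U)⁻¹` is the Cayley transform, with `M = c - U` and `N = i (c + U)`.
  set N : Matrix ι ι ℂ := Complex.I • (c • 1 + (U : Matrix ι ι ℂ)) with hN
  set H : Matrix ι ι ℂ := N * (M⁻¹ : (Matrix ι ι ℂ)ˣ) with hH
  have hHM : H * M = N := by rw [hH, mul_assoc, Units.inv_mul, mul_one]
  have key : star (M : Matrix ι ι ℂ) * N = star N * (M : Matrix ι ι ℂ) := by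
    rw [hN, hM]
    simp only [star_smul, star_sub, star_add, star_one, mul_smul_comm, smul_mul_assoc, mul_add,
      mul_sub, sub_mul, add_mul, mul_one, one_mul, hUU, smul_add, smul_sub, smul_smul, star_mul',
      show star Complex.I = -Complex.I from Complex.conj_I]
    have e1 : Complex.I * (star c * c) = Complex.I := by rw [hcc, mul_one]
    match_scalars <;> first | linear_combination e1 + e1 | ring1
  have hherm : H.IsHermitian := by
    have h1 : star (M : Matrix ι ι ℂ) * H * M = star (M : Matrix ι ι ℂ) * star H * M := by
      rw [mul_assoc, hHM, key, ← hHM, star_mul]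
    have h2 := M.isUnit.mul_right_cancel h1
    have h3 := M.isUnit.star.mul_left_cancel h2
    exact h3.symm
  obtain ⟨W, D, hD⟩ : ∃ (W : Matrix.unitaryGroup ι ℂ) (D : ι → ℝ),
      H * W = W * Matrix.diagonal fun i => (D i : ℂ) := by
    refine ⟨hherm.eigenvectorUnitary, hherm.eigenvalues, ?_⟩
    have hs := congrArg (fun A => A * (hherm.eigenvectorUnitary : Matrix ι ι ℂ))
      hherm.spectral_theorem
    refine hs.trans ?_
    simp only [Unitary.conjStarAlgAut_apply, mul_assoc, Unitary.coe_star_mul_self, mul_one]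
    rfl
  -- In an eigenbasis of `H`, the relation `H (c - U) = i (c + U)` forces `U` to be diagonal.
  set X : Matrix.unitaryGroup ι ℂ := W⁻¹ * U * W with hX
  have hUW : (U : Matrix ι ι ℂ) * W = W * X := by
    rw [← Matrix.UnitaryGroup.mul_val, ← Matrix.UnitaryGroup.mul_val, hX]
    congr 1
    group
  have hDX : ∀ i j, ((D i : ℂ) + Complex.I) * (X : Matrix ι ι ℂ) i j =
      if i = j then c * ((D i : ℂ) - Complex.I) else 0 := by
    have hmat : (Matrix.diagonal fun i => (D i : ℂ)) * (c • 1 - (X : Matrix ι ι ℂ)) =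
        Complex.I • (c • 1 + (X : Matrix ι ι ℂ)) := by
      have hWu : IsUnit (W : Matrix ι ι ℂ) := ⟨Unitary.toUnits W, rfl⟩
      apply hWu.mul_left_cancel
      have e1 : (W : Matrix ι ι ℂ) * (c • 1 - (X : Matrix ι ι ℂ)) = M * W := by
        rw [hM, mul_sub, ← hUW, sub_mul]; simp
      have e2 : (W : Matrix ι ι ℂ) * (Complex.I • (c • 1 + (X : Matrix ι ι ℂ))) = N * W := by
        rw [hN, mul_smul_comm, mul_add, ← hUW, smul_mul_assoc, add_mul]; simp
      rw [← mul_assoc, ← hD, mul_assoc, e1, e2, ← mul_assoc, hHM]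
    intro i j
    have := congrFun (congrFun hmat i) j
    rw [Matrix.diagonal_mul] at this
    simp only [Matrix.sub_apply, Matrix.smul_apply, Matrix.add_apply, Matrix.one_apply,
      smul_eq_mul] at this
    split_ifs at this ⊢ <;> linear_combination -this
  -- The eigenvalues `D i` are real.
  have hne : ∀ i, (D i : ℂ) + Complex.I ≠ 0 := by
    intro i h
    have := congrArg Complex.im h
    simp at this
  have hoff : ∀ i j, i ≠ j → (X : Matrix ι ι ℂ) i j = 0 := by
    intro i j hij
    have := hDX i j
    rw [if_neg hij] at this
    exact (mul_eq_zero.mp this).resolve_left (hne i)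
  have hXd : (X : Matrix ι ι ℂ) = Matrix.diagonal fun i => (X : Matrix ι ι ℂ) i i := by
    ext i j
    by_cases hij : i = j
    · subst hij; simp
    · rw [hoff i j hij, Matrix.diagonal_apply_ne _ hij]
  have hunit : ∀ i, (X : Matrix ι ι ℂ) i i ∈ unitary ℂ := by
    intro i
    have h1 : star (X : Matrix ι ι ℂ) * X = 1 := Unitary.coe_star_mul_self X
    have h2 := congrFun (congrFun h1 i) i
    rw [hXd, Matrix.star_eq_conjTranspose, Matrix.diagonal_conjTranspose,
      Matrix.diagonal_mul_diagonal] at h2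
    simp only [Matrix.diagonal_apply_eq, Matrix.one_apply_eq, Pi.star_apply] at h2
    exact Unitary.mem_iff.mpr ⟨h2, by rw [mul_comm]; exact h2⟩
  refine ⟨W, fun i => ⟨_, hunit i⟩, ?_⟩
  have : diagonalUnitary (fun i => ⟨_, hunit i⟩) = X := by
    ext i j
    rw [coe_diagonalUnitary, ← hXd]
  rw [this, hX]
  group

theorem permUnitary_apply {d : ℕ} (σ : Equiv.Perm (Fin d)) (i j : Fin d) :
    (permUnitary σ : Matrix (Fin d) (Fin d) ℂ) i j = if i = σ j then 1 else 0 := rfl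

theorem permUnitary_mul {d : ℕ} (σ τ : Equiv.Perm (Fin d)) :
    permUnitary (σ * τ) = permUnitary σ * permUnitary τ := by
  ext i j
  simp [Matrix.mul_apply, permUnitary_apply]
  congr

theorem permUnitary_one {d : ℕ} : permUnitary (1 : Equiv.Perm (Fin d)) = 1 := by
  ext i j
  simp [permUnitary_apply, Matrix.one_apply]
  congr

theorem permUnitary_inv {d : ℕ} (σ : Equiv.Perm (Fin d)) :
    permUnitary σ⁻¹ = (permUnitary σ)⁻¹ :=
  eq_inv_of_mul_eq_one_left (by rw [← permUnitary_mul, inv_mul_cancel, permUnitary_one])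

theorem permUnitary_pow {d : ℕ} (σ : Equiv.Perm (Fin d)) (k : ℕ) :
    permUnitary (σ ^ k) = permUnitary σ ^ k := by
  induction k with
  | zero => simp [permUnitary_one]
  | succ k ih => rw [pow_succ, pow_succ, permUnitary_mul, ih]

theorem permUnitary_mul_diagonalUnitary {d : ℕ} (σ : Equiv.Perm (Fin d)) (f : Fin d → unitary ℂ) :
    permUnitary σ * diagonalUnitary f = diagonalUnitary (f ∘ σ.symm) * permUnitary σ := by
  ext i j
  rw [Matrix.UnitaryGroup.mul_val, Matrix.UnitaryGroup.mul_val, coe_diagonalUnitary,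
    coe_diagonalUnitary, Matrix.mul_diagonal, Matrix.diagonal_mul, permUnitary_apply]
  split_ifs with h <;> simp [h]

theorem incUnitary_pow_self (d : ℕ) [NeZero d] : incUnitary d ^ d = 1 := by
  have : Equiv.addRight (1 : Fin d) ^ d = 1 := by
    have h : ∀ k : ℕ, ∀ i : Fin d, (Equiv.addRight (1 : Fin d) ^ k) i = i + Fin.ofNat d k := by
      intro k
      induction k with
      | zero => intro i; simp
      | succ k ih =>
        intro i
        rw [pow_succ', Equiv.Perm.mul_apply, ih, Equiv.coe_addRight]
        beta_reduce
        rw [add_assoc]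
        congr 1
        ext
        simp [Fin.val_add]
    ext i
    rw [h]
    simp [Fin.ofNat]
  rw [incUnitary, ← permUnitary_pow, this, permUnitary_one]

/-! ### Every one-qudit unitary is a phase times a commutator -/

theorem exists_pow_eq_unitary {d : ℕ} (hd : 0 < d) (z : unitary ℂ) :
    ∃ w : unitary ℂ, w ^ d = z := by
  obtain ⟨w, hw⟩ := IsAlgClosed.exists_pow_nat_eq (z : ℂ) hd
  have hz : ‖(z : ℂ)‖ = 1 := CStarRing.norm_coe_unitary z
  have hn : ‖w‖ = 1 := by
    have : ‖w‖ ^ d = 1 := by rw [← norm_pow, hw, hz]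
    exact (pow_eq_one_iff_of_nonneg (norm_nonneg w) hd.ne').mp this
  have h1 : star w * w = 1 := by
    rw [Complex.star_def, Complex.conj_mul', hn]; norm_num
  exact ⟨⟨w, Unitary.mem_iff.mpr ⟨h1, by rw [mul_comm]; exact h1⟩⟩, Subtype.ext (by simpa using hw)⟩

/-- On a cycle, a function with product `1` is a multiplicative coboundary. -/
theorem exists_eq_div_sub_one {G : Type*} [CommGroup G] {d : ℕ} [NeZero d] (f : Fin d → G)
    (hf : ∏ i, f i = 1) : ∃ a : Fin d → G, ∀ j, f j = a j / a (j - 1) := by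
  obtain ⟨m, rfl⟩ : ∃ m, d = m + 1 := ⟨d - 1, (Nat.sub_add_cancel (NeZero.pos d)).symm⟩
  -- The partial products `f 0 ⋯ f j`; the hypothesis closes the cycle at `j = 0`.
  refine ⟨fun j => ∏ i ∈ Finset.range (j + 1), f (Fin.ofNat (m + 1) i), fun j => ?_⟩
  have hall : ∏ i ∈ Finset.range (m + 1), f (Fin.ofNat (m + 1) i) = 1 := by
    rw [← Fin.prod_univ_eq_prod_range, ← hf]
    simp
  obtain rfl | hj := eq_or_ne j 0
  · have : ((0 - 1 : Fin (m + 1)) : ℕ) = m := by simp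
    beta_reduce
    rw [this, hall]
    simp
  · have h1 : ((j - 1 : Fin (m + 1)) : ℕ) + 1 = j := by
      rw [Fin.val_sub_one_of_ne_zero hj]
      have : (j : ℕ) ≠ 0 := fun h => hj (Fin.ext h)
      omega
    beta_reduce
    rw [h1, Finset.prod_range_succ, mul_div_cancel_left]
    simp

/-- Up to a phase and conjugation, every `V ∈ U(d)` is the commutator of a diagonal unitary with
`INC`: a diagonal unitary of determinant `1` is a coboundary along the cycle
`0 → 1 → ⋯ → d - 1 → 0`. -/
theorem exists_eq_phase_mul_conj_commutator {d : ℕ} [NeZero d] (V : OneQudit d) :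
    ∃ (z : unitary ℂ) (W A : OneQudit d),
      V = phaseUnitary z * (W * (A * incUnitary d * A⁻¹ * (incUnitary d)⁻¹) * W⁻¹) := by
  obtain ⟨W, f, hV⟩ := exists_conj_diagonalUnitary V
  obtain ⟨z, hz⟩ := exists_pow_eq_unitary (NeZero.pos d) (∏ i, f i)
  obtain ⟨a, ha⟩ := exists_eq_div_sub_one (fun i => z⁻¹ * f i) (by
    rw [Finset.prod_mul_distrib]
    simp [← hz])
  refine ⟨z, W, diagonalUnitary a, ?_⟩
  have hcomm : diagonalUnitary a * incUnitary d * (diagonalUnitary a)⁻¹ * (incUnitary d)⁻¹ =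
      diagonalUnitary fun i => z⁻¹ * f i := by
    have h1 : incUnitary d * diagonalUnitary (a⁻¹) =
        diagonalUnitary (a⁻¹ ∘ (Equiv.addRight (1 : Fin d)).symm) * incUnitary d :=
      permUnitary_mul_diagonalUnitary _ _
    rw [← map_inv, mul_assoc (diagonalUnitary a), h1, mul_assoc, mul_assoc, mul_inv_cancel,
      mul_one, ← map_mul]
    congr 1
    funext j
    simp [ha j, div_eq_mul_inv, sub_eq_add_neg]
  have hf : diagonalUnitary f = phaseUnitary z * diagonalUnitary fun i => z⁻¹ * f i := by
    rw [phaseUnitary, ← map_mul]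
    congr 1
    funext j
    simp
  rw [hcomm, hV, hf, ← mul_assoc W, ← phaseUnitary_comm]
  simp only [mul_assoc]

/-! ### Uniformly controlled gates -/

/-- The uniformly controlled gate with target `t`: it applies `A r` to the qudit `t` when the other
qudits are in the basis state `r`. These gates form a group, block diagonal with one block for each
`r`. -/
def uniformlyControlled {d n : ℕ} (t : Fin n) :
    (({k // k ≠ t} → Fin d) → OneQudit d) →* QuditUnitary d n where
  toFun A := ⟨(Matrix.blockDiagonal fun r => (A r : Matrix (Fin d) (Fin d) ℂ)).submatrix
      (Equiv.funSplitAt t (Fin d)) (Equiv.funSplitAt t (Fin d)), by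
    rw [Matrix.mem_unitaryGroup_iff, Matrix.star_eq_conjTranspose, Matrix.conjTranspose_submatrix,
      Matrix.blockDiagonal_conjTranspose, Matrix.submatrix_mul_equiv, ← Matrix.blockDiagonal_mul]
    have h : ∀ r, (A r : Matrix (Fin d) (Fin d) ℂ) * (A r : Matrix (Fin d) (Fin d) ℂ).conjTranspose
        = 1 := fun r => Matrix.mem_unitaryGroup_iff.mp (A r).2
    simp only [h]
    exact (congrArg (fun M => Matrix.submatrix M _ _) Matrix.blockDiagonal_one).trans
      (Matrix.submatrix_one_equiv _)⟩
  map_one' := Subtype.ext <|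
    (congrArg (fun M => Matrix.submatrix M _ _) Matrix.blockDiagonal_one).trans
      (Matrix.submatrix_one_equiv _)
  map_mul' A B := by
    apply Subtype.ext
    rw [Matrix.UnitaryGroup.mul_val]
    dsimp only
    rw [Matrix.submatrix_mul_equiv, ← Matrix.blockDiagonal_mul]
    rfl

theorem uniformlyControlled_apply {d n : ℕ} (t : Fin n)
    (A : ({k // k ≠ t} → Fin d) → OneQudit d) (x y : Fin n → Fin d) :
    (uniformlyControlled t A : Matrix (Fin n → Fin d) (Fin n → Fin d) ℂ) x y =
      if ∀ k, k ≠ t → x k = y k then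
        (A fun k => x k : Matrix (Fin d) (Fin d) ℂ) (x t) (y t) else 0 := by
  change Matrix.blockDiagonal (fun r => (A r : Matrix (Fin d) (Fin d) ℂ)) (Equiv.funSplitAt t _ x)
    (Equiv.funSplitAt t _ y) = _
  rw [Matrix.blockDiagonal_apply]
  simp only [Equiv.funSplitAt_apply, funext_iff, Subtype.forall]

theorem uniformlyControlled_diagonalUnitary {d n : ℕ} (t : Fin n)
    (f : ({k // k ≠ t} → Fin d) → Fin d → unitary ℂ) :
    uniformlyControlled t (fun r => diagonalUnitary (f r)) =
      diagonalUnitary fun x : Fin n → Fin d => f (fun k => x k) (x t) := by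
  ext x y
  rw [uniformlyControlled_apply, coe_diagonalUnitary, coe_diagonalUnitary, Matrix.diagonal_apply,
    Matrix.diagonal_apply]
  by_cases h : x = y
  · subst h; simp
  · rw [if_neg h]
    split_ifs with h1 h2
    · exact absurd (funext fun k => if hk : k = t then hk ▸ h2 else h1 k hk) h
    · rfl
    · rfl

/-- The local unitary that applies `V` to the qudit `t`. -/
def singleUnitary {d n : ℕ} (t : Fin n) (V : OneQudit d) : QuditUnitary d n :=
  localUnitary (Pi.mulSingle t V)

theorem singleUnitary_eq_uniformlyControlled {d n : ℕ} (t : Fin n) (V : OneQudit d) :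
    singleUnitary t V = uniformlyControlled t fun _ => V := by
  ext x y
  rw [uniformlyControlled_apply]
  change ∏ k, ((Pi.mulSingle t V : Fin n → OneQudit d) k : Matrix (Fin d) (Fin d) ℂ) (x k) (y k) = _
  rw [Fintype.prod_eq_mul_prod_compl t, Pi.mulSingle_eq_same]
  have : ∀ k ∈ ({t}ᶜ : Finset (Fin n)),
      ((Pi.mulSingle t V : Fin n → OneQudit d) k : Matrix (Fin d) (Fin d) ℂ) (x k) (y k) =
        if x k = y k then 1 else 0 := by
    intro k hk
    rw [Pi.mulSingle_eq_of_ne (by simpa using hk)]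
    exact Matrix.one_apply
  rw [Finset.prod_congr rfl this, Finset.prod_ite_zero]
  simp

theorem controlled_eq_uniformlyControlled {d n : ℕ} (c t : Fin n) (h : c ≠ t) (V : OneQudit d) :
    controlled c t h V =
      uniformlyControlled t fun r => if (r ⟨c, h⟩ : ℕ) + 1 = d then V else 1 := by
  ext x y
  rw [uniformlyControlled_apply]
  change (if _ then (if _ then (V : Matrix (Fin d) (Fin d) ℂ) else 1) (x t) (y t) else 0) = _
  split_ifs <;> rfl

theorem controlled_mul {d n : ℕ} (c t : Fin n) (h : c ≠ t) (V W : OneQudit d) :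
    controlled c t h (V * W) = controlled c t h V * controlled c t h W := by
  simp only [controlled_eq_uniformlyControlled, ← map_mul]
  congr 1
  funext r
  simp only [Pi.mul_apply]
  split_ifs <;> simp

theorem controlled_one {d n : ℕ} (c t : Fin n) (h : c ≠ t) :
    controlled c t h (1 : OneQudit d) = 1 := by
  simp only [controlled_eq_uniformlyControlled, ite_self]
  exact map_one _

theorem controlled_inv {d n : ℕ} (c t : Fin n) (h : c ≠ t) (V : OneQudit d) :
    controlled c t h V⁻¹ = (controlled c t h V)⁻¹ :=
  eq_inv_of_mul_eq_one_left (by rw [← controlled_mul, inv_mul_cancel, controlled_one])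

theorem controlled_pow {d n : ℕ} (c t : Fin n) (h : c ≠ t) (V : OneQudit d) (k : ℕ) :
    controlled c t h (V ^ k) = controlled c t h V ^ k := by
  induction k with
  | zero => simp [controlled_one]
  | succ k ih => rw [pow_succ, pow_succ, controlled_mul, ih]

theorem controlled_conj {d n : ℕ} (c t : Fin n) (h : c ≠ t) (W V : OneQudit d) :
    controlled c t h (W * V * W⁻¹) =
      singleUnitary t W * controlled c t h V * singleUnitary t W⁻¹ := by
  simp only [controlled_eq_uniformlyControlled, singleUnitary_eq_uniformlyControlled, ← map_mul]
  congr 1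
  funext r
  simp only [Pi.mul_apply]
  split_ifs <;> simp

/-- A controlled phase is a diagonal one-qudit unitary on the control. -/
theorem controlled_phaseUnitary {d n : ℕ} (c t : Fin n) (h : c ≠ t) (z : unitary ℂ) :
    controlled c t h (phaseUnitary z : OneQudit d) =
      singleUnitary c (diagonalUnitary fun j : Fin d => if (j : ℕ) + 1 = d then z else 1) := by
  rw [controlled_eq_uniformlyControlled, singleUnitary_eq_uniformlyControlled,
    uniformlyControlled_diagonalUnitary]
  have : (fun r : {k // k ≠ t} → Fin d =>
      if (r ⟨c, h⟩ : ℕ) + 1 = d then (phaseUnitary z : OneQudit d) else 1) =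
      fun r => diagonalUnitary fun _ => if (r ⟨c, h⟩ : ℕ) + 1 = d then z else 1 := by
    funext r
    split_ifs
    · rfl
    · exact (map_one _).symm
  rw [this, uniformlyControlled_diagonalUnitary]

/-! ### Circuits on a pair of qudits -/

/-- `U` has a circuit on the pair `(c, t)` with `a` copies of `CINC`, `b` copies of `CINC⁻¹` and
`f` controlled flips. -/
def HasCircuit {d n : ℕ} [NeZero d] (c t : Fin n) (U : QuditUnitary d n) (a b f : ℕ) : Prop :=
  ∃ C : List (QuditGate d n), (∀ g ∈ C, g.OnPair c t) ∧ IsCircuitFor C U a b f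

namespace HasCircuit

variable {d n : ℕ} [NeZero d] {c t : Fin n}

theorem mul {U V : QuditUnitary d n} {a b f a' b' f' : ℕ} (hU : HasCircuit c t U a b f)
    (hV : HasCircuit c t V a' b' f') : HasCircuit c t (U * V) (a + a') (b + b') (f + f') := by
  obtain ⟨C, hC, h1, h2, h3, h4⟩ := hU
  obtain ⟨C', hC', h1', h2', h3', h4'⟩ := hV
  refine ⟨C ++ C', fun g hg => (List.mem_append.mp hg).elim (hC g) (hC' g), ?_, ?_, ?_, ?_⟩
  · rw [List.map_append, List.prod_append, h1, h1']
  · rw [List.countP_append, h2, h2']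
  · rw [List.countP_append, h3, h3']
  · rw [List.countP_append, h4, h4']

theorem one : HasCircuit c t (1 : QuditUnitary d n) 0 0 0 :=
  ⟨[], by simp, by simp [IsCircuitFor]⟩

theorem singleUnitary_control (V : OneQudit d) : HasCircuit c t (singleUnitary c V) 0 0 0 := by
  refine ⟨[.loc (Pi.mulSingle c V)], ?_, ?_⟩
  · simp only [List.mem_singleton, forall_eq]
    exact fun k hk _ => Pi.mulSingle_eq_of_ne hk _
  · simp [IsCircuitFor, QuditGate.eval, singleUnitary, QuditGate.isCinc, QuditGate.isCincInv,
      QuditGate.isCflip]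

theorem singleUnitary_target (V : OneQudit d) : HasCircuit c t (singleUnitary t V) 0 0 0 := by
  refine ⟨[.loc (Pi.mulSingle t V)], ?_, ?_⟩
  · simp only [List.mem_singleton, forall_eq]
    exact fun k _ hk => Pi.mulSingle_eq_of_ne hk _
  · simp [IsCircuitFor, QuditGate.eval, singleUnitary, QuditGate.isCinc, QuditGate.isCincInv,
      QuditGate.isCflip]

theorem cinc (h : c ≠ t) : HasCircuit c t (cincUnitary c t h : QuditUnitary d n) 1 0 0 :=
  ⟨[.cinc c t h], by simp [QuditGate.OnPair], by
    simp [IsCircuitFor, QuditGate.eval, QuditGate.isCinc, QuditGate.isCincInv,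
      QuditGate.isCflip]⟩

theorem cincInv (h : c ≠ t) : HasCircuit c t (cincUnitary c t h : QuditUnitary d n)⁻¹ 0 1 0 :=
  ⟨[.cincInv c t h], by simp [QuditGate.OnPair], by
    simp [IsCircuitFor, QuditGate.eval, QuditGate.isCinc, QuditGate.isCincInv,
      QuditGate.isCflip]⟩

theorem cflip (h : c ≠ t) : HasCircuit c t (cflipUnitary c t h : QuditUnitary d n) 0 0 1 :=
  ⟨[.cflip c t h], by simp [QuditGate.OnPair], by
    simp [IsCircuitFor, QuditGate.eval, QuditGate.isCinc, QuditGate.isCincInv,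
      QuditGate.isCflip]⟩

theorem controlled_conj {h : c ≠ t} {V : OneQudit d} {a b f : ℕ} (W : OneQudit d)
    (hV : HasCircuit c t (controlled c t h V) a b f) :
    HasCircuit c t (controlled c t h (W * V * W⁻¹)) a b f := by
  rw [_root_.controlled_conj]
  simpa using ((singleUnitary_target W).mul hV).mul (singleUnitary_target W⁻¹)

/-- Pairs `U * U⁻¹` pad a circuit without changing what it computes. -/
theorem padding {U : QuditUnitary d n} {a b f a' b' f' : ℕ} (hU : HasCircuit c t U a b f)
    (hU' : HasCircuit c t U⁻¹ a' b' f') (k : ℕ) :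
    HasCircuit c t (1 : QuditUnitary d n) (k * (a + a')) (k * (b + b')) (k * (f + f')) := by
  induction k with
  | zero => simpa using one
  | succ k ih =>
    have := ih.mul (hU.mul hU')
    rw [mul_inv_cancel, mul_one] at this
    simpa only [Nat.succ_mul] using this

/-- Circuits for `CINC` and `CINC⁻¹` yield a circuit for every `∧₁(V)` in which each of the two is
used `d` times. One copy of each suffices; the others are padding. -/
theorem controlled_of_cinc {h : c ≠ t} {a b f a' b' f' : ℕ}
    (h₁ : HasCircuit c t (cincUnitary c t h : QuditUnitary d n) a b f)
    (h₂ : HasCircuit c t (cincUnitary c t h : QuditUnitary d n)⁻¹ a' b' f') (V : OneQudit d) :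
    HasCircuit c t (controlled c t h V) (d * (a + a')) (d * (b + b')) (d * (f + f')) := by
  obtain ⟨z, W, A, hV⟩ := exists_eq_phase_mul_conj_commutator V
  have hinc : HasCircuit c t (controlled c t h (incUnitary d)) a b f := h₁
  have hinc' : HasCircuit c t (controlled c t h (incUnitary d)⁻¹) a' b' f' := by
    rw [controlled_inv]; exact h₂
  have hcomm : HasCircuit c t (controlled c t h V) (a + a') (b + b') (f + f') := by
    rw [hV, controlled_mul, controlled_phaseUnitary]
    have h3 : HasCircuit c t
        (controlled c t h (A * incUnitary d * A⁻¹ * (incUnitary d)⁻¹)) (a + a') (b + b')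
          (f + f') := by
      rw [controlled_mul]
      exact (controlled_conj A hinc).mul hinc'
    simpa only [zero_add] using (singleUnitary_control _).mul (controlled_conj W h3)
  obtain ⟨m, hm⟩ : ∃ m, d = m + 1 := ⟨d - 1, (Nat.sub_add_cancel (NeZero.pos d)).symm⟩
  have := (h₁.padding h₂ m).mul hcomm
  rw [one_mul, ← Nat.succ_mul, ← Nat.succ_mul, ← Nat.succ_mul, Nat.succ_eq_add_one, ← hm] at this
  exact this

theorem controlled_swap (hd : 2 ≤ d) (h : c ≠ t) {i j : Fin d} (hij : i ≠ j) :
    HasCircuit c t (controlled c t h (permUnitary (Equiv.swap i j))) 0 0 1 := by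
  have h01 : (0 : Fin d) ≠ 1 := by
    intro h
    have := congrArg Fin.val h
    rw [Fin.val_zero, Fin.val_one', Nat.mod_eq_of_lt hd] at this
    omega
  obtain ⟨σ, hσ⟩ := isConj_iff.mp (Equiv.Perm.isConj_swap h01 hij)
  rw [← hσ, permUnitary_mul, permUnitary_mul, permUnitary_inv]
  exact controlled_conj _ (cflip h)

/-- A cycle of length `l` is a product of `l - 1` transpositions. -/
theorem controlled_formPerm (hd : 2 ≤ d) (h : c ≠ t) (l : List (Fin d)) (hl : l.Nodup) :
    HasCircuit c t (controlled c t h (permUnitary l.formPerm)) 0 0 (l.length - 1) := by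
  induction l with
  | nil => simpa [permUnitary_one, controlled_one] using one
  | cons i l ih =>
    cases l with
    | nil => simpa [permUnitary_one, controlled_one] using one
    | cons j l =>
      rw [List.formPerm_cons_cons, permUnitary_mul, controlled_mul]
      have hij : i ≠ j := fun e => (List.nodup_cons.mp hl).1 (by simp [e])
      have := (controlled_swap (n := n) hd h hij).mul (ih (List.nodup_cons.mp hl).2)
      simpa [add_comm] using this

end HasCircuit

/-- `INC` permutes the levels as the cycle `(0 1 ⋯ d-1)`. -/
theorem formPerm_finRange (d : ℕ) [NeZero d] :
    (List.finRange d).formPerm = Equiv.addRight (1 : Fin d) := by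
  ext i
  have := List.formPerm_apply_getElem (List.finRange d) (List.nodup_finRange d) i (by simp)
  simp only [List.getElem_finRange, List.length_finRange, Fin.cast_mk, Fin.eta] at this
  rw [this]
  simp [Fin.val_add]

theorem hasCircuit_cinc_of_cflip {d n : ℕ} [NeZero d] (hd : 2 ≤ d) {c t : Fin n} (h : c ≠ t) :
    HasCircuit c t (cincUnitary c t h : QuditUnitary d n) 0 0 (d - 1) := by
  have := HasCircuit.controlled_formPerm hd h _ (List.nodup_finRange d)
  rwa [formPerm_finRange, List.length_finRange] at this

theorem hasCircuit_cincInv_of_cflip {d n : ℕ} [NeZero d] (hd : 2 ≤ d) {c t : Fin n} (h : c ≠ t) :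
    HasCircuit c t (cincUnitary c t h : QuditUnitary d n)⁻¹ 0 0 (d - 1) := by
  have := HasCircuit.controlled_formPerm hd h _ (List.nodup_reverse.mpr (List.nodup_finRange d))
  rwa [List.formPerm_reverse, formPerm_finRange, List.length_reverse, List.length_finRange,
    permUnitary_inv, controlled_inv] at this

theorem cincUnitary_inv {d n : ℕ} [NeZero d] (c t : Fin n) (h : c ≠ t) :
    (cincUnitary c t h : QuditUnitary d n)⁻¹ = cincUnitary c t h ^ (d - 1) := by
  refine inv_eq_of_mul_eq_one_left ?_
  rw [← pow_succ, Nat.sub_add_cancel (NeZero.pos d), cincUnitary, ← controlled_pow,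
    incUnitary_pow_self, controlled_one]

/-! ### Multiply controlled gates -/

theorem uniformlyControlled_mulVec {d n : ℕ} (t : Fin n)
    (A : ({k // k ≠ t} → Fin d) → OneQudit d) (v : (Fin n → Fin d) → ℂ) (x : Fin n → Fin d) :
    ((uniformlyControlled t A : Matrix (Fin n → Fin d) (Fin n → Fin d) ℂ).mulVec v) x =
      ((A fun k => x k : Matrix (Fin d) (Fin d) ℂ).mulVec
        fun a => v ((Equiv.funSplitAt t (Fin d)).symm (a, fun k => x k))) (x t) := by
  change (((Matrix.blockDiagonal fun r => (A r : Matrix (Fin d) (Fin d) ℂ)).submatrix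
      (Equiv.funSplitAt t (Fin d)) (Equiv.funSplitAt t (Fin d))).mulVec v) x = _
  rw [Matrix.submatrix_mulVec_equiv]
  simp [Matrix.mulVec, dotProduct, Fintype.sum_prod_type, Matrix.blockDiagonal_apply, ite_mul]

/-- The multiply controlled gate: it applies `V` to the qudit `t` when every qudit `k ≠ t` of `S` is
in the state `|z k⟩`. -/
def multiControlled {d n : ℕ} (t : Fin n) (S : Finset (Fin n)) (z : Fin n → Fin d)
    (V : OneQudit d) : QuditUnitary d n :=
  uniformlyControlled t fun r => if ∀ k : {k // k ≠ t}, k.1 ∈ S → r k = z k then V else 1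

theorem multiControlled_mul {d n : ℕ} (t : Fin n) (S : Finset (Fin n)) (z : Fin n → Fin d)
    (V W : OneQudit d) :
    multiControlled t S z (V * W) = multiControlled t S z V * multiControlled t S z W := by
  simp only [multiControlled, ← map_mul]
  congr 1
  funext r
  simp only [Pi.mul_apply]
  split_ifs <;> simp

theorem multiControlled_empty {d n : ℕ} (t : Fin n) (z : Fin n → Fin d) (V : OneQudit d) :
    multiControlled t ∅ z V = singleUnitary t V := by
  simp [multiControlled, singleUnitary_eq_uniformlyControlled]

/-- The commutator of two controlled gates acts only when both sets of controls are satisfied. -/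
theorem multiControlled_insert_commutator {d n : ℕ} (c t : Fin n)
    (S : Finset (Fin n)) (z : Fin n → Fin d) (A B : OneQudit d) :
    multiControlled t (insert c S) z (A * B * A⁻¹ * B⁻¹) =
      multiControlled t S z A * multiControlled t {c} z B * (multiControlled t S z A)⁻¹ *
        (multiControlled t {c} z B)⁻¹ := by
  simp only [multiControlled, ← map_mul, ← map_inv]
  congr 1
  funext r
  have key : (∀ k : {k // k ≠ t}, k.1 ∈ insert c S → r k = z k) ↔
      (∀ k : {k // k ≠ t}, k.1 ∈ S → r k = z k) ∧
        ∀ k : {k // k ≠ t}, k.1 ∈ ({c} : Finset (Fin n)) → r k = z k := by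
    simp only [Finset.mem_insert, Finset.mem_singleton, or_imp, forall_and, and_comm]
  simp only [Pi.mul_apply, Pi.inv_apply, key]
  have aux : ∀ (p q : Prop) [Decidable p] [Decidable q],
      (if p ∧ q then A * B * A⁻¹ * B⁻¹ else 1) =
        (if p then A else 1) * (if q then B else 1) * (if p then A else 1)⁻¹ *
          (if q then B else 1)⁻¹ := by
    intro p q _ _
    by_cases hp : p <;> by_cases hq : q <;> simp [hp, hq]
  exact aux _ _

/-- A multiply controlled phase can be moved from its target to one of its controls, which then
needs one control less. -/
theorem multiControlled_insert_phaseUnitary {d n : ℕ} {c t : Fin n} {S : Finset (Fin n)}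
    (hc : c ∉ S) (ht : t ∉ insert c S) (z : Fin n → Fin d) (w : unitary ℂ) :
    multiControlled t (insert c S) z (phaseUnitary w) =
      multiControlled c S z (diagonalUnitary fun j => if j = z c then w else 1) := by
  have e : ∀ (p : Prop) [Decidable p] (f : Fin d → unitary ℂ),
      (if p then (diagonalUnitary f : OneQudit d) else 1) =
        diagonalUnitary fun j => if p then f j else 1 := by
    intro p _ f
    split_ifs
    · rfl
    · exact (map_one _).symm
  simp only [multiControlled, phaseUnitary, e, uniformlyControlled_diagonalUnitary]
  congr 1
  funext x
  rw [← ite_and]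
  refine if_congr ?_ rfl rfl
  rw [Finset.mem_insert, not_or] at ht
  constructor
  · intro H
    refine ⟨fun k hk => H ⟨k.1, fun e => ht.2 (e ▸ hk)⟩ (Finset.mem_insert_of_mem hk),
      H ⟨c, fun e => ht.1 e.symm⟩ (Finset.mem_insert_self _ _)⟩
  · rintro ⟨H, Hc⟩ ⟨k, hkt⟩ hk
    obtain rfl | hk := Finset.mem_insert.mp hk
    · exact Hc
    · exact H ⟨k, fun e => hc (e ▸ hk)⟩ hk

theorem singleUnitary_permUnitary_apply {d n : ℕ} (c : Fin n) (σ : Equiv.Perm (Fin d))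
    (x y : Fin n → Fin d) :
    (singleUnitary c (permUnitary σ) : Matrix (Fin n → Fin d) (Fin n → Fin d) ℂ) x y =
      if x = Function.update y c (σ (y c)) then 1 else 0 := by
  rw [singleUnitary_eq_uniformlyControlled, uniformlyControlled_apply, permUnitary_apply,
    ← ite_and]
  refine if_congr ?_ rfl rfl
  rw [Function.eq_update_iff, and_comm]

/-- Exchanging two levels of the control changes the level at which a controlled gate is
triggered. -/
theorem multiControlled_singleton {d n : ℕ} [NeZero d] (c t : Fin n) (h : c ≠ t)
    (z : Fin n → Fin d) (V : OneQudit d) :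
    multiControlled t {c} z V =
      singleUnitary c (permUnitary (Equiv.swap (z c) (Fin.rev 0))) * controlled c t h V *
        (singleUnitary c (permUnitary (Equiv.swap (z c) (Fin.rev 0))))⁻¹ := by
  rw [eq_mul_inv_iff_mul_eq, controlled_eq_uniformlyControlled]
  -- `Fin.rev 0` is the level `d - 1` at which `controlled` is triggered.
  set σ := Equiv.swap (z c) (Fin.rev 0) with hσ
  have hσσ : ∀ j, σ (σ j) = j := Equiv.swap_apply_self _ _
  set τ : (Fin n → Fin d) → Fin n → Fin d := fun y => Function.update y c (σ (y c)) with hτ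
  have hττ : Function.Involutive τ := fun y => by
    funext k
    by_cases hk : k = c
    · subst hk; simp [hτ, hσσ]
    · simp [hτ, hk]
  ext x y
  rw [Matrix.UnitaryGroup.mul_val, Matrix.UnitaryGroup.mul_val, Matrix.mul_apply, Matrix.mul_apply,
    Finset.sum_eq_single (τ y), Finset.sum_eq_single (τ x)]
  · rw [singleUnitary_permUnitary_apply, singleUnitary_permUnitary_apply, if_pos rfl,
      if_pos (hττ x).symm, mul_one, one_mul, multiControlled, uniformlyControlled_apply,
      uniformlyControlled_apply]
    have h1 : (∀ k, k ≠ t → x k = τ y k) ↔ ∀ k, k ≠ t → τ x k = y k := by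
      refine forall_congr' fun k => imp_congr_right fun _ => ?_
      by_cases hk : k = c
      · subst hk
        simp only [hτ, Function.update_self]
        exact ⟨fun e => by rw [e, hσσ], fun e => by rw [← e, hσσ]⟩
      · simp [hτ, hk]
    have h2 : (∀ k : {k // k ≠ t}, k.1 ∈ ({c} : Finset (Fin n)) → x k = z k) ↔
        (τ x c : ℕ) + 1 = d := by
      have h3 : (τ x c : ℕ) + 1 = d ↔ σ (x c) = Fin.rev 0 := by
        rw [Fin.ext_iff, Fin.val_rev, Fin.val_zero]
        simp only [hτ, Function.update_self]
        have := NeZero.pos d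
        omega
      have h4 : σ (x c) = Fin.rev 0 ↔ x c = z c := by
        rw [← σ.apply_eq_iff_eq (x := x c), hσ, Equiv.swap_apply_left]
      rw [h3, h4]
      exact ⟨fun H => H ⟨c, h⟩ (Finset.mem_singleton_self c), fun H k hk => by
        rw [Finset.mem_singleton.mp hk, H]⟩
    have h5 : ∀ y, τ y t = y t := fun y => by simp [hτ, h.symm]
    simp only [h1, h2, h5]
  · intro w _ hw
    rw [singleUnitary_permUnitary_apply, if_neg, zero_mul]
    exact fun e => hw (hττ.eq_iff.mp e.symm)
  · simp
  · intro w _ hw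
    rw [singleUnitary_permUnitary_apply, if_neg hw, mul_zero]
  · simp

/-! ### Universality -/

section Universality

variable {d n : ℕ} [NeZero d] {G : Subgroup (QuditUnitary d n)}

/-- Induction on the controls: up to a phase, `V` is a commutator, so its multiply controlled
version is a commutator of gates with fewer controls, and the phase moves to a control. -/
theorem multiControlled_mem (hloc : ∀ W, localUnitary W ∈ G)
    (hctrl : ∀ (c t : Fin n) (h : c ≠ t) (V : OneQudit d), controlled c t h V ∈ G)
    (z : Fin n → Fin d) (S : Finset (Fin n)) :
    ∀ t ∉ S, ∀ V, multiControlled t S z V ∈ G := by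
  induction S using Finset.induction_on with
  | empty =>
    intro t _ V
    rw [multiControlled_empty]
    exact hloc _
  | insert c S hc ih =>
    intro t ht V
    have htc : c ≠ t := fun e => ht (e ▸ Finset.mem_insert_self _ _)
    have htS : t ∉ S := fun e => ht (Finset.mem_insert_of_mem e)
    obtain ⟨w, W, A, hV⟩ := exists_eq_phase_mul_conj_commutator V
    have hB : ∀ B, multiControlled t {c} z B ∈ G := fun B => by
      rw [multiControlled_singleton c t htc]
      exact mul_mem (mul_mem (hloc _) (hctrl _ _ _ _)) (inv_mem (hloc _))
    -- Conjugation turns a commutator into the commutator of the conjugates.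
    have hconj : W * (A * incUnitary d * A⁻¹ * (incUnitary d)⁻¹) * W⁻¹ =
        (W * A * W⁻¹) * (W * incUnitary d * W⁻¹) * (W * A * W⁻¹)⁻¹ *
          (W * incUnitary d * W⁻¹)⁻¹ := by group
    rw [hV, multiControlled_mul, multiControlled_insert_phaseUnitary hc ht, hconj,
      multiControlled_insert_commutator c t]
    exact mul_mem (ih c hc _) (mul_mem (mul_mem (mul_mem (ih t htS _) (hB _))
      (inv_mem (ih t htS _))) (inv_mem (hB _)))

/-- The uniformly controlled gates with target `t` are generated by the fully controlled ones, which
act on a single block. -/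
theorem uniformlyControlled_mem (hloc : ∀ W, localUnitary W ∈ G)
    (hctrl : ∀ (c t : Fin n) (h : c ≠ t) (V : OneQudit d), controlled c t h V ∈ G)
    (t : Fin n) (A : ({k // k ≠ t} → Fin d) → OneQudit d) : uniformlyControlled t A ∈ G := by
  refine Subgroup.pi_mem_of_mulSingle_mem (H := G.comap (uniformlyControlled t)) A fun r => ?_
  rw [Subgroup.mem_comap]
  have := multiControlled_mem hloc hctrl ((Equiv.funSplitAt t (Fin d)).symm (0, r))
    (Finset.univ.erase t) t (Finset.notMem_erase _ _) (A r)
  convert this using 1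
  rw [multiControlled]
  congr 1
  funext s
  rw [Pi.mulSingle_apply]
  refine if_congr ?_ rfl rfl
  rw [funext_iff]
  refine forall_congr' fun k => ?_
  simp [k.2]

theorem diagonalUnitary_mem (hloc : ∀ W, localUnitary W ∈ G)
    (hctrl : ∀ (c t : Fin n) (h : c ≠ t) (V : OneQudit d), controlled c t h V ∈ G)
    (t : Fin n) (f : (Fin n → Fin d) → unitary ℂ) : diagonalUnitary f ∈ G := by
  have := uniformlyControlled_mem hloc hctrl t fun r =>
    diagonalUnitary fun a => f ((Equiv.funSplitAt t (Fin d)).symm (a, r))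
  rw [uniformlyControlled_diagonalUnitary] at this
  convert this using 3 with x
  exact congrArg f ((Equiv.funSplitAt t (Fin d)).symm_apply_apply x).symm

/-- Every one-qudit vector is rotated to a multiple of `|0⟩` by a unitary. -/
theorem exists_oneQudit_mulVec_eq_zero (u : Fin d → ℂ) :
    ∃ V : OneQudit d, ∀ a, a ≠ 0 → ((V : Matrix (Fin d) (Fin d) ℂ).mulVec u) a = 0 := by
  by_cases hu : u = 0
  · exact ⟨1, fun a _ => by simp [hu]⟩
  -- Express `u` in an orthonormal basis whose vector `0` is the normalization of `u`.
  set w : EuclideanSpace ℂ (Fin d) := WithLp.toLp 2 u with hw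
  have hw0 : ‖w‖ ≠ 0 := by
    rw [norm_ne_zero_iff]
    exact fun h => hu (by simpa [hw] using h)
  obtain ⟨b, hb⟩ := Orthonormal.exists_orthonormalBasis_extension_of_card_eq (𝕜 := ℂ)
    (E := EuclideanSpace ℂ (Fin d)) (ι := Fin d) (by simp)
    (v := fun _ => ((‖w‖⁻¹ : ℝ) : ℂ) • w) (s := {0}) (by
      rw [orthonormal_subsingleton_iff]
      intro i
      simp [norm_smul, hw0])
  have hb0 := hb 0 rfl
  refine ⟨⟨_, b.toMatrix_orthonormalBasis_mem_unitary (EuclideanSpace.basisFun (Fin d) ℂ)⟩,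
    fun a ha => ?_⟩
  have h1 := Module.Basis.toMatrix_mulVec_repr (EuclideanSpace.basisFun (Fin d) ℂ).toBasis
    b.toBasis w
  have h2 : b.repr w a = 0 := by
    rw [b.repr_apply_apply]
    have : w = (‖w‖ : ℂ) • b 0 := by
      rw [hb0, smul_smul, ← Complex.ofReal_mul, mul_inv_cancel₀ hw0]
      simp
    rw [this, inner_smul_right, b.orthonormal.2 ha, mul_zero]
  have h3 := congrFun h1 a
  simp only [OrthonormalBasis.coe_toBasis_repr_apply, h2] at h3
  exact h3

/-- A vector is moved to a multiple of `|0 … 0⟩` one qudit at a time: a uniformly controlled gate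
rotates every fibre over the other qudits to a multiple of `|0⟩`. -/
theorem exists_mem_mulVec_eq_zero (hloc : ∀ W, localUnitary W ∈ G)
    (hctrl : ∀ (c t : Fin n) (h : c ≠ t) (V : OneQudit d), controlled c t h V ∈ G)
    (v : (Fin n → Fin d) → ℂ) (S : Finset (Fin n)) :
    ∃ g ∈ G, ∀ x : Fin n → Fin d, (∃ k ∈ S, x k ≠ 0) →
      ((g : Matrix (Fin n → Fin d) (Fin n → Fin d) ℂ).mulVec v) x = 0 := by
  induction S using Finset.induction_on with
  | empty => exact ⟨1, one_mem _, by simp⟩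
  | insert t S ht ih =>
    obtain ⟨g, hg, hgv⟩ := ih
    set w := (g : Matrix (Fin n → Fin d) (Fin n → Fin d) ℂ).mulVec v with hw
    choose A hA using fun r : {k // k ≠ t} → Fin d =>
      exists_oneQudit_mulVec_eq_zero fun a => w ((Equiv.funSplitAt t (Fin d)).symm (a, r))
    refine ⟨uniformlyControlled t A * g, mul_mem (uniformlyControlled_mem hloc hctrl t A) hg, ?_⟩
    rintro x ⟨k, hk, hxk⟩
    rw [Matrix.UnitaryGroup.mul_val, ← Matrix.mulVec_mulVec, ← hw, uniformlyControlled_mulVec]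
    by_cases hxt : x t = 0
    · have hkt : k ≠ t := fun e => hxk (e ▸ hxt)
      have hkS : k ∈ S := (Finset.mem_insert.mp hk).resolve_left hkt
      have : (fun a => w ((Equiv.funSplitAt t (Fin d)).symm (a, fun k => x k))) = 0 := by
        funext a
        exact hgv _ ⟨k, hkS, by simpa [hkt] using hxk⟩
      rw [this, Matrix.mulVec_zero, Pi.zero_apply]
    · exact hA _ _ hxt

/-- A unitary with orthonormal eigenvectors `b j` is a product of unitaries that multiply one `b j`
by a phase; moving `b j` to `|0 … 0⟩` turns such a factor into a diagonal gate. -/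
theorem eq_top_of_local_of_controlled (hn : 1 ≤ n) (hloc : ∀ W, localUnitary W ∈ G)
    (hctrl : ∀ (c t : Fin n) (h : c ≠ t) (V : OneQudit d), controlled c t h V ∈ G) : G = ⊤ := by
  rw [eq_top_iff]
  rintro U -
  obtain ⟨B, f, rfl⟩ := exists_conj_diagonalUnitary U
  refine Subgroup.pi_mem_of_mulSingle_mem
    (H := G.comap ((MulAut.conj B).toMonoidHom.comp diagonalUnitary)) f fun j => ?_
  change B * diagonalUnitary (Pi.mulSingle j (f j)) * B⁻¹ ∈ G
  obtain ⟨g, hg, hgv⟩ := exists_mem_mulVec_eq_zero hloc hctrl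
    (fun x => (B : Matrix (Fin n → Fin d) (Fin n → Fin d) ℂ) x j) Finset.univ
  obtain ⟨X, hX⟩ : ∃ X, X = g * B := ⟨_, rfl⟩
  have hcol : ∀ x, x ≠ 0 → (X : Matrix (Fin n → Fin d) (Fin n → Fin d) ℂ) x j = 0 := by
    intro x hx
    obtain ⟨k, hk⟩ := Function.ne_iff.mp hx
    rw [hX]
    exact hgv x ⟨k, Finset.mem_univ _, hk⟩
  have horth : ∀ y, star ((X : Matrix (Fin n → Fin d) (Fin n → Fin d) ℂ) 0 j) *
      (X : Matrix (Fin n → Fin d) (Fin n → Fin d) ℂ) 0 y = if j = y then 1 else 0 := by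
    intro y
    have h1 : star (X : Matrix (Fin n → Fin d) (Fin n → Fin d) ℂ) * X = 1 :=
      Unitary.coe_star_mul_self X
    have h2 := congrFun (congrFun h1 j) y
    rw [Matrix.mul_apply, Finset.sum_eq_single 0, Matrix.star_apply, Matrix.one_apply] at h2
    · exact h2
    · intro x _ hx
      rw [Matrix.star_apply, hcol x hx, star_zero, zero_mul]
    · simp
  -- Column `j` of `X` is concentrated at `0`, and by unitarity so is row `0` at `j`.
  have hrow : ∀ y, y ≠ j → (X : Matrix (Fin n → Fin d) (Fin n → Fin d) ℂ) 0 y = 0 := by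
    intro y hy
    have h1 := horth j
    have h2 := horth y
    rw [if_pos rfl] at h1
    rw [if_neg hy.symm] at h2
    exact (mul_eq_zero.mp h2).resolve_left (left_ne_zero_of_mul_eq_one h1)
  have hcomm : X * diagonalUnitary (Pi.mulSingle j (f j)) =
      diagonalUnitary (Pi.mulSingle 0 (f j)) * X := by
    ext x y
    rw [Matrix.UnitaryGroup.mul_val X, Matrix.UnitaryGroup.mul_val _ X, coe_diagonalUnitary,
      coe_diagonalUnitary, Matrix.mul_diagonal, Matrix.diagonal_mul]
    by_cases hy : y = j <;> by_cases hx : x = 0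
    · subst hy hx
      rw [Pi.mulSingle_eq_same, Pi.mulSingle_eq_same, mul_comm]
    · rw [hy, hcol x hx, zero_mul, mul_zero]
    · rw [hx, hrow y hy, zero_mul, mul_zero]
    · rw [Pi.mulSingle_eq_of_ne hy, Pi.mulSingle_eq_of_ne hx, mul_comm]
  have hfinal : B * diagonalUnitary (Pi.mulSingle j (f j)) * B⁻¹ =
      g⁻¹ * diagonalUnitary (Pi.mulSingle 0 (f j)) * g := by
    have hB : B = g⁻¹ * X := by rw [hX]; group
    rw [hB, mul_assoc g⁻¹ X, hcomm]
    group
  rw [hfinal]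
  exact mul_mem (mul_mem (inv_mem hg) (diagonalUnitary_mem hloc hctrl ⟨0, hn⟩ _)) hg

end Universality

theorem localUnitary_inv {d n : ℕ} (W : Fin n → OneQudit d) :
    (localUnitary W)⁻¹ = localUnitary W⁻¹ := by
  ext x y
  change star (∏ k, (W k : Matrix (Fin d) (Fin d) ℂ) (y k) (x k)) = _
  rw [star_prod]
  rfl

theorem HasCircuit.mem {d n : ℕ} [NeZero d] {c t : Fin n} {U : QuditUnitary d n} {a b : ℕ}
    (hU : HasCircuit c t U a b 0) {G : Subgroup (QuditUnitary d n)}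
    (hloc : ∀ W, localUnitary W ∈ G)
    (hcinc : ∀ (c t : Fin n) (h : c ≠ t), cincUnitary c t h ∈ G) : U ∈ G := by
  obtain ⟨C, -, rfl, -, -, h0⟩ := hU
  refine Subgroup.list_prod_mem _ fun U hU => ?_
  obtain ⟨g, hg, rfl⟩ := List.mem_map.mp hU
  have := List.countP_eq_zero.mp h0 g hg
  cases g with
  | loc W => exact hloc W
  | cinc c t h => exact hcinc c t h
  | cincInv c t h => exact inv_mem (hcinc c t h)
  | cflip c t h => exact absurd rfl this

theorem isExactUniversal_local_union_cinc {d n : ℕ} [NeZero d] (hn : 1 ≤ n) :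
    IsExactUniversal (localGates d n ∪ cincGates d n) := by
  set L := localGates d n ∪ cincGates d n with hL
  have hloc : ∀ W, localUnitary W ∈ L := fun W => Or.inl ⟨W, rfl⟩
  have hcinc : ∀ (c t : Fin n) (h : c ≠ t), cincUnitary c t h ∈ L :=
    fun c t h => Or.inr ⟨c, t, h, rfl⟩
  have htop : Subgroup.closure L = ⊤ := by
    refine eq_top_of_local_of_controlled hn (fun W => Subgroup.subset_closure (hloc W))
      fun c t h V => ?_
    exact ((HasCircuit.cinc h).controlled_of_cinc (.cincInv h) V).mem
      (fun W => Subgroup.subset_closure (hloc W))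
      fun c t h => Subgroup.subset_closure (hcinc c t h)
  have hinv : L⁻¹ ⊆ Submonoid.closure L := by
    intro U hU
    rcases hU with ⟨W, hW⟩ | ⟨c, t, h, hc⟩
    · rw [← inv_inv U, ← hW, localUnitary_inv]
      exact Submonoid.subset_closure (hloc _)
    · rw [← inv_inv U, hc, cincUnitary_inv]
      exact pow_mem (Submonoid.subset_closure (hcinc c t h)) _
  intro U
  refine Submonoid.exists_list_of_mem_closure (s := L) ?_
  have hU : U ∈ (Subgroup.closure L).toSubmonoid := by rw [htop]; trivial
  rw [Subgroup.closure_toSubmonoid] at hU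
  exact Submonoid.closure_le.mpr (Set.union_subset Submonoid.subset_closure hinv) hU

theorem IsExactUniversal.mono {d n : ℕ} {L L' : Set (QuditUnitary d n)} (h : L ⊆ L')
    (hL : IsExactUniversal L) : IsExactUniversal L' := fun U =>
  let ⟨l, hl, hU⟩ := hL U
  ⟨l, fun g hg => h (hl g hg), hU⟩

theorem mainTheorem1 (d n : ℕ) [NeZero d] (hd : 2 ≤ d) (hn : 1 ≤ n) :
    -- `∧₁(V)` from local unitaries, `d` copies of `CINC` and `d` copies of `CINC⁻¹`
    (∀ (c t : Fin n) (h : c ≠ t) (V : OneQudit d), ∃ C : List (QuditGate d n),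
      (∀ g ∈ C, g.OnPair c t) ∧ IsCircuitFor C (controlled c t h V) d d 0) ∧
    -- `CINC` and `CINC⁻¹` from local unitaries and `d - 1` controlled flips each
    (∀ (c t : Fin n) (h : c ≠ t), ∃ C : List (QuditGate d n),
      (∀ g ∈ C, g.OnPair c t) ∧ IsCircuitFor C (cincUnitary c t h) 0 0 (d - 1)) ∧
    (∀ (c t : Fin n) (h : c ≠ t), ∃ C : List (QuditGate d n),
      (∀ g ∈ C, g.OnPair c t) ∧ IsCircuitFor C (cincUnitary c t h)⁻¹ 0 0 (d - 1)) ∧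
    -- `∧₁(V)` from local unitaries and `2d(d-1)` controlled flips
    (∀ (c t : Fin n) (h : c ≠ t) (V : OneQudit d), ∃ C : List (QuditGate d n),
      (∀ g ∈ C, g.OnPair c t) ∧ IsCircuitFor C (controlled c t h V) 0 0 (2 * d * (d - 1))) ∧
    -- `CINC⁻¹ = CINC^(d-1)`
    (∀ (c t : Fin n) (h : c ≠ t),
      (cincUnitary c t h : QuditUnitary d n)⁻¹ = cincUnitary c t h ^ (d - 1)) ∧
    -- exact universality
    IsExactUniversal (localGates d n ∪ (cincGates d n ∪ cincInvGates d n)) ∧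
    IsExactUniversal (localGates d n ∪ cincGates d n) := by
  have huniv : IsExactUniversal (localGates d n ∪ cincGates d n) :=
    isExactUniversal_local_union_cinc hn
  refine ⟨fun c t h V => ?_, fun c t h => hasCircuit_cinc_of_cflip hd h,
    fun c t h => hasCircuit_cincInv_of_cflip hd h, fun c t h V => ?_, cincUnitary_inv,
    huniv.mono (Set.union_subset_union_right _ Set.subset_union_left), huniv⟩
  · have := (HasCircuit.cinc h).controlled_of_cinc (.cincInv h) V
    rwa [add_zero, zero_add, add_zero, mul_one, mul_zero] at this
  · have := (hasCircuit_cinc_of_cflip hd h).controlled_of_cinc (hasCircuit_cincInv_of_cflip hd h) V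
    rwa [add_zero, mul_zero, ← two_mul, mul_left_comm, ← mul_assoc] at this
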